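/- Call a complete metric space $X$ in which any two points are joined by a unique geodesic \emph{uniformly convex} if for each $\varepsilon>0$ there is $\delta>0$ such that for all $x,y,z\in X$ with $d(x,y)\ge \varepsilon\max(d(x,z),d(y,z))$ the midpoint $m$ of the geodesic from $x$ to $y$ satisfies $d(z,m)\le(1-\delta)\max(d(x,z),d(y,z))$. Let $\mathcal X$ be a family of uniformly convex metric spaces (isometric spaces being identified) such that (a) $\mathcal X$ is stable under rescaled ultraproducts: for every set $I$, every ultrafilter $\mathcal U$ on $I$ and all triples $(X_i,\lambda_i,x_i)_{i\in I}$ with $X_i\in\mathcal X$, $x_i\in X_i$, $\lambda_i>0$, the ultraproduct along $\mathcal U$ of the pointed metric spaces $(X_i,\lambda_i d_{X_i},x_i)$ belongs to $\mathcal X$; this ultraproduct consists of the families $(y_i)_{i\in I}\in\prod_i X_i$ with $\sup_i\lambda_i d_{X_i}(x_i,y_i)<\infty$, with the metric $\lim_{\mathcal U}\lambda_i d_{X_i}(y_i,z_i)$, two families being identified when this limit is $0$; (b) every non-empty closed (geodesically) convex subset of a member of $\mathcal X$ belongs to $\mathcal X$. Let $G$ be a compactly generated locally compact Hausdorff group.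 Suppose that every continuous isometric action of $G$ on a non-empty member $X$ of $\mathcal X$ has almost fixed points: for every $\varepsilon>0$ and every relatively compact $B\subseteq G$ there is $x\in X$ with $d(gx,x)\le\varepsilon$ for all $g\in B$. Then $G$ has property F$\mathcal X$, in its topological and in its coarse form: every continuous isometric action of $G$ on a non-empty member of $\mathcal X$ has a fixed point, and so does every (not necessarily continuous) isometric action of $G$ on a non-empty member of $\mathcal X$ for which the orbits $Bx$ of all relatively compact subsets $B\subseteq G$ are bounded. -/

import Mathlib

open Set Filter Topology
open scoped NNReal

universe u v

section Geodesics

variable {X : Type u} [MetricSpace X]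

/-- `γ`, restricted to `[0, 1]`, is a geodesic from `x` to `y`, parametrized proportionally to
arc length. The values of `γ` outside `[0, 1]` are irrelevant. -/
structure IsGeodesic (γ : ℝ → X) (x y : X) : Prop where
  source : γ 0 = x
  target : γ 1 = y
  dist_eq : ∀ s ∈ Icc (0 : ℝ) 1, ∀ t ∈ Icc (0 : ℝ) 1, dist (γ s) (γ t) = |s - t| * dist x y

/-- The union of the geodesics from `x` to `y`; in a uniquely geodesic space this is the geodesic
segment `[x, y]`. -/
def geodesicSegment (x y : X) : Set X :=
  {z | ∃ γ : ℝ → X, IsGeodesic γ x y ∧ ∃ t ∈ Icc (0 : ℝ) 1, γ t = z}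

/-- `m` is the midpoint of a geodesic from `x` to `y`. -/
def IsGeodesicMidpoint (m x y : X) : Prop :=
  ∃ γ : ℝ → X, IsGeodesic γ x y ∧ γ (1 / 2) = m

/-- `A` is convex: it contains the geodesic segment between any two of its points. -/
def IsGeodesicallyConvex (A : Set X) : Prop :=
  ∀ x ∈ A, ∀ y ∈ A, geodesicSegment x y ⊆ A

end Geodesics

/-- Any two points are joined by exactly one geodesic. -/
structure IsUniquelyGeodesic (X : Type u) [MetricSpace X] : Prop where
  exists_geodesic : ∀ x y : X, ∃ γ : ℝ → X, IsGeodesic γ x y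
  unique_geodesic : ∀ (x y : X) (γ γ' : ℝ → X),
    IsGeodesic γ x y → IsGeodesic γ' x y → EqOn γ γ' (Icc 0 1)

/-- Uniformly convex metric spaces: complete, uniquely geodesic, and for each `ε > 0` there is
`δ > 0` such that `|xy| ≥ ε max(|xz|, |yz|)` implies `|z m_{xy}| ≤ (1 - δ) max(|xz|, |yz|)`. -/
structure IsUniformlyConvexMetricSpace (X : Type u) [MetricSpace X] : Prop where
  complete : CompleteSpace X
  uniquelyGeodesic : IsUniquelyGeodesic X
  uniformlyConvex : ∀ ε : ℝ, 0 < ε → ∃ δ : ℝ, 0 < δ ∧ ∀ x y z m : X,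
    IsGeodesicMidpoint m x y → ε * max (dist x z) (dist y z) ≤ dist x y →
      dist z m ≤ (1 - δ) * max (dist x z) (dist y z)

section Ultraproduct

variable {I : Type u} (𝒰 : Ultrafilter I) (X : I → Type u) [∀ i, MetricSpace (X i)]
  (c : I → ℝ≥0) (o : ∀ i, X i)

/-- Families `(y i)` in `∏ i, X i` at bounded distance from the base points `o i`, for the
rescaled metrics `c i * dist`. The ultrafilter enters only through the metric below. -/
structure BoundedFamily (𝒰 : Ultrafilter I) (X : I → Type u) [∀ i, MetricSpace (X i)]
    (c : I → ℝ≥0) (o : ∀ i, X i) : Type u where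
  val : ∀ i, X i
  bounded : ∃ C : ℝ, ∀ i, (c i : ℝ) * dist (o i) (val i) ≤ C

variable {𝒰 X c o}

/-- The limit along `𝒰` of the rescaled distances between two bounded families. -/
noncomputable def BoundedFamily.limDist (y z : BoundedFamily 𝒰 X c o) : ℝ :=
  limUnder (𝒰 : Filter I) (fun i => (c i : ℝ) * dist (y.val i) (z.val i))

theorem BoundedFamily.tendsto_limDist (y z : BoundedFamily 𝒰 X c o) :
    Tendsto (fun i => (c i : ℝ) * dist (y.val i) (z.val i)) 𝒰 (𝓝 (y.limDist z)) := by
  obtain ⟨C, hC⟩ := y.bounded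
  obtain ⟨D, hD⟩ := z.bounded
  have hmem : ∀ i, (c i : ℝ) * dist (y.val i) (z.val i) ∈ Icc (0 : ℝ) (C + D) := by
    intro i
    refine ⟨by positivity, ?_⟩
    calc (c i : ℝ) * dist (y.val i) (z.val i)
        ≤ (c i : ℝ) * (dist (o i) (y.val i) + dist (o i) (z.val i)) := by
          gcongr
          exact dist_triangle_left _ _ _
      _ ≤ C + D := by
          rw [mul_add]
          exact add_le_add (hC i) (hD i)
  obtain ⟨a, -, ha⟩ := (isCompact_Icc (a := (0 : ℝ)) (b := C + D)).ultrafilter_le_nhds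
    (𝒰.map fun i => (c i : ℝ) * dist (y.val i) (z.val i))
    (by
      rw [le_principal_iff]
      exact Filter.mem_map.2 (Filter.univ_mem' hmem))
  exact tendsto_nhds_limUnder ⟨a, ha⟩

noncomputable instance BoundedFamily.instPseudoMetricSpace :
    PseudoMetricSpace (BoundedFamily 𝒰 X c o) where
  dist := BoundedFamily.limDist
  dist_self y := by
    refine tendsto_nhds_unique (y.tendsto_limDist y) ?_
    simp
  dist_comm y z := by
    refine tendsto_nhds_unique (y.tendsto_limDist z) ?_
    simpa only [dist_comm] using z.tendsto_limDist y
  dist_triangle y z w := by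
    refine le_of_tendsto_of_tendsto' (y.tendsto_limDist w)
      ((y.tendsto_limDist z).add (z.tendsto_limDist w)) fun i => ?_
    rw [← mul_add]
    exact mul_le_mul_of_nonneg_left (dist_triangle _ _ _) (c i).coe_nonneg

variable (𝒰 X c o)

/-- The ultraproduct along `𝒰` of the pointed metric spaces `(X i, c i * dist, o i)`: bounded
families modulo being at limit distance `0`, with the limit distance. -/
abbrev RescaledUltraproduct : Type u :=
  SeparationQuotient (BoundedFamily 𝒰 X c o)

end Ultraproduct

section Families

/-- Some member of the family `𝒳` is isometric to `Y`. -/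
def MemUpToIsometry (𝒳 : (X : Type u) → [MetricSpace X] → Prop) (Y : Type u) [MetricSpace Y] :
    Prop :=
  ∃ (X : Type u) (_ : MetricSpace X), 𝒳 X ∧ Nonempty (X ≃ᵢ Y)

/-- The family `𝒳` is stable under rescaled ultraproducts. -/
def StableUnderRescaledUltraproducts (𝒳 : (X : Type u) → [MetricSpace X] → Prop) : Prop :=
  ∀ (I : Type u) (𝒰 : Ultrafilter I) (X : I → Type u) [∀ i, MetricSpace (X i)]
    (c : I → ℝ≥0) (o : ∀ i, X i), (∀ i, 𝒳 (X i)) → (∀ i, 0 < c i) →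
      MemUpToIsometry 𝒳 (RescaledUltraproduct 𝒰 X c o)

/-- The family `𝒳` is closed under taking (non-empty) closed convex subspaces. -/
def ClosedUnderClosedConvexSubspaces (𝒳 : (X : Type u) → [MetricSpace X] → Prop) : Prop :=
  ∀ (X : Type u) [MetricSpace X], 𝒳 X →
    ∀ C : Set X, C.Nonempty → IsClosed C → IsGeodesicallyConvex C → MemUpToIsometry 𝒳 C

end Families

section Actions

/-- The group `G` is generated by a compact subset. -/
def IsCompactlyGeneratedGroup (G : Type v) [Group G] [TopologicalSpace G] : Prop :=
  ∃ K : Set G, IsCompact K ∧ Subgroup.closure K = ⊤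

/-- The action of `G` on `X` has almost fixed points, with respect to a bornology on `G`. -/
def HasAlmostFixedPoints (G : Type v) [Group G] (ℬ : Bornology G)
    (X : Type u) [MetricSpace X] [MulAction G X] : Prop :=
  ∀ ε : ℝ, 0 < ε → ∀ B : Set G, @Bornology.IsBounded G ℬ B →
    ∃ x : X, ∀ g ∈ B, dist (g • x) x ≤ ε

/-- The action of `G` on `X` is controlled, with respect to a bornology on `G`: orbits of bounded
sets are bounded. -/
def IsControlledAction (G : Type v) [Group G] (ℬ : Bornology G)
    (X : Type u) [MetricSpace X] [MulAction G X] : Prop :=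
  ∀ A : Set G, @Bornology.IsBounded G ℬ A → ∀ x : X, Bornology.IsBounded ((fun g => g • x) '' A)

/-- Topological property F`𝒳`: every continuous isometric action of `G` on a (non-empty) member of
`𝒳` has a fixed point. -/
def TopologicalPropertyF (𝒳 : (X : Type u) → [MetricSpace X] → Prop)
    (G : Type v) [Group G] [TopologicalSpace G] : Prop :=
  ∀ (X : Type u) [MetricSpace X] [Nonempty X] [MulAction G X] [IsIsometricSMul G X]
    [ContinuousSMul G X], 𝒳 X → ∃ x : X, ∀ g : G, g • x = x

/-- Coarse property F`𝒳`, for a bornology on `G`: every controlled isometric action of `G` on a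
(non-empty) member of `𝒳` has a fixed point. -/
def CoarsePropertyF (𝒳 : (X : Type u) → [MetricSpace X] → Prop)
    (G : Type v) [Group G] (ℬ : Bornology G) : Prop :=
  ∀ (X : Type u) [MetricSpace X] [Nonempty X] [MulAction G X] [IsIsometricSMul G X],
    𝒳 X → IsControlledAction G ℬ X → ∃ x : X, ∀ g : G, g • x = x

end Actions

/-! Suppose a controlled action on `X ∈ 𝒳` has no fixed point, and let `K` be a compact generating
neighbourhood of 1. The displacement of `K` is then positive everywhere, and Hofer's lemma gives
points `o n` such that displacement at least halves nowhere below that of `o n` on a ball of radius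
`n + 1` times it. Rescaling the displacement at `o n` to 1 and passing to the ultraproduct yields an
isometric action on a member of `𝒳`, where almost fixed points would contradict the lower bound 1/2.

The obstacle is that almost fixed points are only available for continuous actions, while rescaling
may destroy continuity. The remedy is to restrict to the families whose orbit maps are
equicontinuous at 1 along the ultrafilter. They form a closed, convex, invariant set, hence a member
of `𝒳`, on which `G` acts continuously.

That this set is non-empty is the crux (`exists_isEquicontinuous`). Minimize the radius within which
a family contains the orbit of the base points under small neighbourhoods of 1. Uniform convexity
makes almost minimizers cluster, so a minimizer exists; moving it by elements tending to 1 gives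
almost minimizers again, so these barely move it. Finally, equicontinuity turns almost fixedness
under each element of `K` into a bound uniform on `K` at a single index. -/

section Transport

/-! ### Transport along isometries. -/

variable {X Y : Type u} [MetricSpace X] [MetricSpace Y]

theorem IsGeodesic.comp_isometry {γ : ℝ → X} {x y : X} (h : IsGeodesic γ x y) {f : X → Y}
    (hf : Isometry f) : IsGeodesic (f ∘ γ) (f x) (f y) where
  source := congrArg f h.source
  target := congrArg f h.target
  dist_eq s hs t ht := by
    simpa only [Function.comp_apply, hf.dist_eq] using h.dist_eq s hs t ht

theorem IsUniquelyGeodesic.of_isometryEquiv (hX : IsUniquelyGeodesic X) (e : X ≃ᵢ Y) :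
    IsUniquelyGeodesic Y where
  exists_geodesic x y := by
    obtain ⟨γ, hγ⟩ := hX.exists_geodesic (e.symm x) (e.symm y)
    exact ⟨e ∘ γ, by simpa using hγ.comp_isometry e.isometry⟩
  unique_geodesic x y γ γ' h h' t ht := e.symm.injective
    (hX.unique_geodesic _ _ _ _ (h.comp_isometry e.symm.isometry)
      (h'.comp_isometry e.symm.isometry) ht)

theorem IsGeodesicallyConvex.preimage {C : Set Y} (hC : IsGeodesicallyConvex C) {f : X → Y}
    (hf : Isometry f) : IsGeodesicallyConvex (f ⁻¹' C) := by
  rintro x hx y hy _ ⟨γ, hγ, t, ht, rfl⟩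
  exact hC _ hx _ hy ⟨f ∘ γ, hγ.comp_isometry hf, t, ht, rfl⟩

/-- An isometry restricts to an isometry from the preimage of a set onto this set. -/
def IsometryEquiv.preimageSubtype (e : X ≃ᵢ Y) (C : Set Y) : (e ⁻¹' C : Set X) ≃ᵢ C where
  toEquiv := e.toEquiv.subtypeEquiv fun _ => Iff.rfl
  isometry_toFun := Isometry.of_dist_eq fun x y => e.dist_eq x y

theorem MemUpToIsometry.subspace {𝒳 : (X : Type u) → [MetricSpace X] → Prop}
    (h𝒳 : ClosedUnderClosedConvexSubspaces 𝒳) (hY : MemUpToIsometry 𝒳 Y) {C : Set Y}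
    (hne : C.Nonempty) (hcl : IsClosed C) (hconv : IsGeodesicallyConvex C) :
    MemUpToIsometry 𝒳 C := by
  obtain ⟨X, _, hX, ⟨e⟩⟩ := hY
  obtain ⟨Z, _, hZ, ⟨e'⟩⟩ := h𝒳 X hX (e ⁻¹' C) (hne.preimage e.surjective)
    (hcl.preimage e.continuous) (hconv.preimage e.isometry)
  exact ⟨Z, _, hZ, ⟨e'.trans (e.preimageSubtype C)⟩⟩

/-- Conjugating the action by the isometry moves it to an actual member of `𝒳`, the only place where
the hypothesis applies. -/
theorem HasAlmostFixedPoints.of_memUpToIsometry {G : Type v} [Group G] [TopologicalSpace G]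
    {ℬ : Bornology G} {𝒳 : (X : Type u) → [MetricSpace X] → Prop}
    (h : ∀ (X : Type u) [MetricSpace X] [Nonempty X] [MulAction G X] [IsIsometricSMul G X]
      [ContinuousSMul G X], 𝒳 X → HasAlmostFixedPoints G ℬ X)
    [Nonempty Y] [MulAction G Y] [IsIsometricSMul G Y] [ContinuousSMul G Y]
    (hY : MemUpToIsometry 𝒳 Y) : HasAlmostFixedPoints G ℬ Y := by
  obtain ⟨X, _, hX, ⟨e⟩⟩ := hY
  let _ : MulAction G X := e.toEquiv.mulAction G
  have smul_def : ∀ (g : G) (x : X), g • x = e.symm (g • e x) := fun _ _ => rfl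
  have : Nonempty X := e.toEquiv.nonempty
  have : IsIsometricSMul G X := ⟨fun g => Isometry.of_dist_eq fun x y => by
    simp only [smul_def, e.symm.dist_eq, dist_smul, e.dist_eq]⟩
  have : ContinuousSMul G X := ⟨by
    simp only [smul_def]
    exact e.symm.continuous.comp (continuous_fst.smul (e.continuous.comp continuous_snd))⟩
  intro ε hε B hB
  obtain ⟨x, hx⟩ := h X hX ε hε B hB
  refine ⟨e x, fun g hg => ?_⟩
  have := hx g hg
  rwa [smul_def, ← e.dist_eq, e.apply_symm_apply] at this

end Transport

theorem dist_inv_smul_eq {X : Type u} [MetricSpace X] {G : Type v} [Group G] [MulAction G X]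
    [IsIsometricSMul G X] (g : G) (x y : X) : dist (g⁻¹ • x) y = dist x (g • y) := by
  rw [← dist_smul g, smul_inv_smul]

/-! ### Scale-invariant consequences of uniform convexity. -/

section UniformConvexity

variable {X : Type u} [MetricSpace X]

theorem IsUniformlyConvexMetricSpace.exists_midpoint (hX : IsUniformlyConvexMetricSpace X)
    (x y : X) : ∃ m, IsGeodesicMidpoint m x y :=
  let ⟨γ, hγ⟩ := hX.uniquelyGeodesic.exists_geodesic x y
  ⟨_, γ, hγ, rfl⟩

theorem IsGeodesic.dist_source {γ : ℝ → X} {x y : X} (h : IsGeodesic γ x y) {t : ℝ}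
    (ht : t ∈ Icc (0 : ℝ) 1) : dist (γ t) x = t * dist x y := by
  have := h.dist_eq t ht 0 ⟨le_rfl, zero_le_one⟩
  rwa [h.source, sub_zero, abs_of_nonneg ht.1] at this

theorem IsGeodesic.dist_target {γ : ℝ → X} {x y : X} (h : IsGeodesic γ x y) {t : ℝ}
    (ht : t ∈ Icc (0 : ℝ) 1) : dist (γ t) y = (1 - t) * dist x y := by
  have := h.dist_eq t ht 1 ⟨zero_le_one, le_rfl⟩
  rwa [h.target, abs_sub_comm, abs_of_nonneg (sub_nonneg.2 ht.2)] at this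

/-- Uniform convexity is invariant under rescaling of the metric. -/
theorem IsUniformlyConvexMetricSpace.exists_modulus (hX : IsUniformlyConvexMetricSpace X)
    {ε : ℝ} (hε : 0 < ε) : ∃ δ : ℝ, 0 < δ ∧ δ ≤ 1 ∧ ∀ (c R : ℝ) (x y z m : X), 0 < c →
      IsGeodesicMidpoint m x y → c * dist x z ≤ R → c * dist y z ≤ R → ε * R ≤ c * dist x y →
        c * dist z m ≤ (1 - δ) * R := by
  obtain ⟨δ, hδ, h⟩ := hX.uniformlyConvex ε hε
  -- Capping `δ` at 1 keeps `1 - δ` nonnegative, so the maximum may be replaced by the larger `R`.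
  refine ⟨min δ 1, by positivity, min_le_right _ _, fun c R x y z m hc hm hx hy hxy => ?_⟩
  have hR : c * max (dist x z) (dist y z) ≤ R := by
    rw [mul_max_of_nonneg _ _ hc.le]
    exact max_le hx hy
  have hε' : ε * max (dist x z) (dist y z) ≤ dist x y := by
    refine le_of_mul_le_mul_left ?_ hc
    calc c * (ε * max (dist x z) (dist y z)) = ε * (c * max (dist x z) (dist y z)) := by ring
      _ ≤ ε * R := by gcongr
      _ ≤ c * dist x y := hxy
  have hmax : 0 ≤ max (dist x z) (dist y z) := dist_nonneg.trans (le_max_left _ _)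
  calc c * dist z m ≤ c * ((1 - δ) * max (dist x z) (dist y z)) := by
        gcongr
        exact h x y z m hm hε'
    _ ≤ c * ((1 - min δ 1) * max (dist x z) (dist y z)) := by
        gcongr
        exact min_le_left _ _
    _ = (1 - min δ 1) * (c * max (dist x z) (dist y z)) := by ring
    _ ≤ (1 - min δ 1) * R :=
        mul_le_mul_of_nonneg_left hR (sub_nonneg.2 (min_le_right _ _))

/-- In a uniformly convex metric space, geodesics of bounded length depend continuously on their
endpoints, uniformly and independently of the scale. -/
theorem IsUniformlyConvexMetricSpace.exists_dist_geodesic_le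
    (hX : IsUniformlyConvexMetricSpace X) {L ε : ℝ} (hL : 0 ≤ L) (hε : 0 < ε) :
    ∃ η : ℝ, 0 < η ∧ ∀ (c : ℝ) (x y x' y' : X) (γ γ' : ℝ → X) (t : ℝ), 0 < c →
      IsGeodesic γ x y → IsGeodesic γ' x' y' → t ∈ Icc (0 : ℝ) 1 → c * dist x y ≤ L →
      c * dist x x' ≤ η → c * dist y y' ≤ η → c * dist (γ t) (γ' t) ≤ ε := by
  obtain ⟨δ, hδ, hδ1, h⟩ := hX.exists_modulus (ε := ε / (L + 3)) (by positivity)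
  -- If `γ t` and `γ' t` are far apart, their midpoint is too close to both `x` and `y`: summing
  -- gives `δ * D ≤ 6 * η`. As `ε < 2 * D + 3 * η`, this forces `δ * ε < 15 * η`. The bound `η ≤ 1`
  -- keeps the radii below `L + 3`.
  refine ⟨min 1 (δ * ε / 15), by positivity, ?_⟩
  intro c x y x' y' γ γ' t hc hγ hγ' ht hD hx hy
  set η := min 1 (δ * ε / 15) with hη
  have hη1 : η ≤ 1 := min_le_left _ _
  have hη2 : η ≤ δ * ε / 15 := min_le_right _ _
  have hη0 : 0 < η := by positivity
  by_contra! hlt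
  obtain ⟨m, hm⟩ := hX.exists_midpoint (γ t) (γ' t)
  set D := c * dist x y with hDdef
  have hD0 : 0 ≤ D := by positivity
  have ht0 := ht.1
  have ht1 : 0 ≤ 1 - t := sub_nonneg.2 ht.2
  have hD' : c * dist x' y' ≤ D + 2 * η := by
    have := mul_le_mul_of_nonneg_left (dist_triangle4 x' x y y') hc.le
    rw [dist_comm x' x] at this
    linarith
  have h1 : c * dist (γ t) x = t * D := by rw [hγ.dist_source ht]; ring
  have h2 : c * dist (γ t) y = (1 - t) * D := by rw [hγ.dist_target ht]; ring
  have h3 : c * dist (γ' t) x ≤ t * D + 3 * η := by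
    have := mul_le_mul_of_nonneg_left (dist_triangle_right (γ' t) x x') hc.le
    rw [hγ'.dist_source ht] at this
    nlinarith [mul_le_mul_of_nonneg_left hD' ht0, mul_nonneg hη0.le ht1]
  have h4 : c * dist (γ' t) y ≤ (1 - t) * D + 3 * η := by
    have := mul_le_mul_of_nonneg_left (dist_triangle_right (γ' t) y y') hc.le
    rw [hγ'.dist_target ht] at this
    nlinarith [mul_le_mul_of_nonneg_left hD' ht1, mul_nonneg hη0.le ht0]
  have htD : t * D ≤ D := mul_le_of_le_one_left hD0 ht.2
  have htD0 : 0 ≤ t * D := by positivity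
  have hscale : ∀ R, R ≤ L + 3 → ε / (L + 3) * R ≤ c * dist (γ t) (γ' t) := fun R hR => by
    refine le_trans ?_ hlt.le
    rw [div_mul_eq_mul_div, div_le_iff₀ (by positivity)]
    gcongr
  have h5 := h c (t * D + 3 * η) _ _ x m hc hm (by linarith) h3 (hscale _ (by linarith))
  have h6 := h c ((1 - t) * D + 3 * η) _ _ y m hc hm (by linarith) h4 (hscale _ (by linarith))
  have h7 := mul_le_mul_of_nonneg_left (dist_triangle_right x y m) hc.le
  have h8 := mul_le_mul_of_nonneg_left (dist_triangle_right (γ t) (γ' t) x) hc.le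
  have h9 : δ * D ≤ 6 * η := by nlinarith [mul_pos hδ hη0]
  have h10 : δ * ε < δ * (2 * D + 3 * η) := mul_lt_mul_of_pos_left (by linarith) hδ
  nlinarith [mul_le_mul_of_nonneg_right hδ1 hη0.le]

end UniformConvexity

/-! ### Metric and geodesics of the ultraproduct. -/

namespace BoundedFamily

variable {I : Type u} {𝒰 : Ultrafilter I}

section Metric

variable {X : I → Type u} [∀ i, MetricSpace (X i)] {c : I → ℝ≥0} {o : ∀ i, X i}

theorem val_injective :
    Function.Injective (BoundedFamily.val : BoundedFamily 𝒰 X c o → ∀ i, X i) :=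
  fun ⟨_, _⟩ ⟨_, _⟩ h => by cases h; rfl

theorem tendsto_dist (y z : BoundedFamily 𝒰 X c o) :
    Tendsto (fun i => (c i : ℝ) * dist (y.val i) (z.val i)) 𝒰 (𝓝 (dist y z)) :=
  y.tendsto_limDist z

theorem dist_le_of_eventually {y z : BoundedFamily 𝒰 X c o} {t : ℝ}
    (h : ∀ᶠ i in 𝒰, (c i : ℝ) * dist (y.val i) (z.val i) ≤ t) : dist y z ≤ t :=
  le_of_tendsto (y.tendsto_dist z) h

theorem le_dist_of_eventually {y z : BoundedFamily 𝒰 X c o} {t : ℝ}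
    (h : ∀ᶠ i in 𝒰, t ≤ (c i : ℝ) * dist (y.val i) (z.val i)) : t ≤ dist y z :=
  ge_of_tendsto (y.tendsto_dist z) h

theorem eventually_le_of_dist_lt {y z : BoundedFamily 𝒰 X c o} {t : ℝ} (h : dist y z < t) :
    ∀ᶠ i in 𝒰, (c i : ℝ) * dist (y.val i) (z.val i) ≤ t :=
  ((y.tendsto_dist z).eventually_lt_const h).mono fun _ => le_of_lt

/-- A family at bounded distance from a bounded family is bounded. -/
def ofBoundedDist (y : BoundedFamily 𝒰 X c o) (w : ∀ i, X i)
    (h : ∃ C : ℝ, ∀ i, (c i : ℝ) * dist (y.val i) (w i) ≤ C) : BoundedFamily 𝒰 X c o where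
  val := w
  bounded := by
    obtain ⟨C, hC⟩ := y.bounded
    obtain ⟨D, hD⟩ := h
    refine ⟨C + D, fun i => ?_⟩
    have := mul_le_mul_of_nonneg_left (dist_triangle (o i) (y.val i) (w i)) (c i).coe_nonneg
    linarith [hC i, hD i]

theorem exists_dist_bound (y z : BoundedFamily 𝒰 X c o) :
    ∃ C : ℝ, ∀ i, (c i : ℝ) * dist (y.val i) (z.val i) ≤ C := by
  obtain ⟨C, hC⟩ := y.bounded
  obtain ⟨D, hD⟩ := z.bounded
  refine ⟨C + D, fun i => ?_⟩
  have := mul_le_mul_of_nonneg_left (dist_triangle_left (y.val i) (z.val i) (o i))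
    (c i).coe_nonneg
  linarith [hC i, hD i]

/-- The points at time `t` of geodesics between the members of two bounded families. -/
def geodesicPoint (y z : BoundedFamily 𝒰 X c o) {γ : ∀ i, ℝ → X i}
    (hγ : ∀ i, IsGeodesic (γ i) (y.val i) (z.val i)) (t : Icc (0 : ℝ) 1) :
    BoundedFamily 𝒰 X c o :=
  y.ofBoundedDist (fun i => γ i t) <| by
    obtain ⟨C, hC⟩ := y.exists_dist_bound z
    refine ⟨C, fun i => le_trans ?_ (hC i)⟩
    rw [dist_comm, (hγ i).dist_source t.2]
    gcongr
    exact mul_le_of_le_one_left dist_nonneg t.2.2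

/-- Once the ultraproduct is known to be uniquely geodesic, all its geodesics are of this
coordinatewise form. `projIcc` only fills in the irrelevant values outside `[0, 1]`. -/
theorem isGeodesic_mk_geodesicPoint (y z : BoundedFamily 𝒰 X c o) {γ : ∀ i, ℝ → X i}
    (hγ : ∀ i, IsGeodesic (γ i) (y.val i) (z.val i)) :
    IsGeodesic (fun t => (SeparationQuotient.mk
      (y.geodesicPoint z hγ (projIcc 0 1 zero_le_one t)) : RescaledUltraproduct 𝒰 X c o))
      (SeparationQuotient.mk y) (SeparationQuotient.mk z) where
  source := by
    rw [SeparationQuotient.mk_eq_mk, Metric.inseparable_iff]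
    refine le_antisymm (dist_le_of_eventually (Eventually.of_forall fun i => ?_)) dist_nonneg
    simp [geodesicPoint, ofBoundedDist, (hγ i).source]
  target := by
    rw [SeparationQuotient.mk_eq_mk, Metric.inseparable_iff]
    refine le_antisymm (dist_le_of_eventually (Eventually.of_forall fun i => ?_)) dist_nonneg
    simp [geodesicPoint, ofBoundedDist, (hγ i).target]
  dist_eq s hs t ht := by
    rw [projIcc_of_mem _ hs, projIcc_of_mem _ ht, SeparationQuotient.dist_mk,
      SeparationQuotient.dist_mk]
    refine tendsto_nhds_unique (tendsto_dist _ _)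
      (((y.tendsto_dist z).const_mul |s - t|).congr fun i => ?_)
    simp only [geodesicPoint, ofBoundedDist, (hγ i).dist_eq s hs t ht]
    ring

end Metric

/-! ### Asymptotic centers and equicontinuous families. -/

section Action

variable {X : Type u} [MetricSpace X] {c : I → ℝ≥0} {o : I → X}
  {G : Type v} [Group G] [MulAction G X]

variable [TopologicalSpace G]

variable (G) in
/-- The orbit maps of the members of the family are equicontinuous at `1` along `𝒰`, for the
rescaled metrics. -/
def IsEquicontinuous (y : BoundedFamily 𝒰 (fun _ => X) c o) : Prop :=
  ∀ η : ℝ, 0 < η → ∃ U ∈ 𝓝 (1 : G), ∀ᶠ i in 𝒰, ∀ g ∈ U,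
    (c i : ℝ) * dist (g • y.val i) (y.val i) ≤ η

variable (G) in
/-- Infinitesimally, the orbit of the base points is within distance `t` of `y`. -/
def IsOrbitBound (y : BoundedFamily 𝒰 (fun _ => X) c o) (t : ℝ) : Prop :=
  ∃ U ∈ 𝓝 (1 : G), ∀ᶠ i in 𝒰, ∀ g ∈ U, (c i : ℝ) * dist (g • o i) (y.val i) ≤ t

theorem IsOrbitBound.nonneg {y : BoundedFamily 𝒰 (fun _ => X) c o} {t : ℝ}
    (h : y.IsOrbitBound G t) : 0 ≤ t := by
  obtain ⟨U, hU, h⟩ := h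
  obtain ⟨i, hi⟩ := h.exists
  exact le_trans (by positivity) (hi 1 (mem_of_mem_nhds hU))

theorem IsOrbitBound.mono {y : BoundedFamily 𝒰 (fun _ => X) c o} {s t : ℝ}
    (h : y.IsOrbitBound G s) (hst : s ≤ t) : y.IsOrbitBound G t :=
  let ⟨U, hU, h⟩ := h
  ⟨U, hU, h.mono fun _ hi g hg => (hi g hg).trans hst⟩

theorem IsOrbitBound.of_dist_lt {y z : BoundedFamily 𝒰 (fun _ => X) c o} {s t : ℝ}
    (h : y.IsOrbitBound G s) (hyz : dist y z < t) : z.IsOrbitBound G (s + t) := by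
  obtain ⟨U, hU, h⟩ := h
  refine ⟨U, hU, (h.and (eventually_le_of_dist_lt hyz)).mono fun i hi g hg => ?_⟩
  have := mul_le_mul_of_nonneg_left (dist_triangle (g • o i) (y.val i) (z.val i))
    (c i).coe_nonneg
  linarith [hi.1 g hg, hi.2]

/-- Families whose orbit bound is almost minimal are close to each other. -/
theorem exists_dist_le_of_isOrbitBound (hX : IsUniformlyConvexMetricSpace X)
    (hc : ∀ i, 0 < c i) {r : ℝ} (hr0 : 0 ≤ r)
    (hr : ∀ (y : BoundedFamily 𝒰 (fun _ => X) c o) (t : ℝ), y.IsOrbitBound G t → r ≤ t)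
    {ε : ℝ} (hε : 0 < ε) : ∃ η : ℝ, 0 < η ∧ ∀ y z : BoundedFamily 𝒰 (fun _ => X) c o,
      y.IsOrbitBound G (r + η) → z.IsOrbitBound G (r + η) → dist y z ≤ ε := by
  -- For `r = 0` the choice `δ * r / 2` below would vanish; there the triangle inequality through `o
  -- i` suffices.
  rcases hr0.eq_or_lt with rfl | hr0
  · refine ⟨ε / 2, by positivity, fun y z ⟨U, hU, hy⟩ ⟨V, hV, hz⟩ => ?_⟩
    refine dist_le_of_eventually ((hy.and hz).mono fun i hi => ?_)
    have h1 := hi.1 1 (mem_of_mem_nhds hU)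
    have h2 := hi.2 1 (mem_of_mem_nhds hV)
    have := mul_le_mul_of_nonneg_left (dist_triangle_left (y.val i) (z.val i) ((1 : G) • o i))
      (c i).coe_nonneg
    linarith
  obtain ⟨δ, hδ, hδ1, h⟩ := hX.exists_modulus (ε := ε / (r + 1)) (by positivity)
  refine ⟨min 1 (δ * r / 2), by positivity, fun y z hy hz => ?_⟩
  set η := min 1 (δ * r / 2) with hη
  have hη1 : η ≤ 1 := min_le_left _ _
  have hη2 : η ≤ δ * r / 2 := min_le_right _ _
  have hη0 : 0 < η := by positivity
  obtain ⟨U, hU, hy⟩ := hy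
  obtain ⟨V, hV, hz⟩ := hz
  by_contra! hlt
  choose γ hγ using fun i => hX.uniquelyGeodesic.exists_geodesic (y.val i) (z.val i)
  -- The midpoint family has orbit bound `(1 - δ) * (r + η)`, which is less than `r` since `η ≤ δ *
  -- r / 2`.
  let m := y.geodesicPoint z hγ ⟨1 / 2, by norm_num, by norm_num⟩
  have hm : m.IsOrbitBound G ((1 - δ) * (r + η)) := by
    refine ⟨U ∩ V, inter_mem hU hV, ?_⟩
    filter_upwards [hy, hz, (y.tendsto_dist z).eventually_const_lt hlt] with i hyi hzi hi g hg
    refine h (c i) (r + η) _ _ (g • o i) (m.val i) (hc i) ⟨γ i, hγ i, rfl⟩ ?_ ?_ ?_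
    · rw [dist_comm]
      exact hyi g hg.1
    · rw [dist_comm]
      exact hzi g hg.2
    · refine le_trans ?_ hi.le
      rw [div_mul_eq_mul_div, div_le_iff₀ (by positivity)]
      gcongr
  have := hr m _ hm
  nlinarith [mul_pos hδ hη0, mul_pos hδ hr0]

variable [IsIsometricSMul G X]

/-- The infinitesimal asymptotic center of the orbit of the base points is equicontinuous. -/
theorem exists_isEquicontinuous [IsTopologicalGroup G] (hX : IsUniformlyConvexMetricSpace X)
    (hc : ∀ i, 0 < c i) [CompleteSpace (BoundedFamily 𝒰 (fun _ => X) c o)]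
    {U : Set G} (hU : U ∈ 𝓝 1) {C : ℝ}
    (hC : ∀ i, ∀ g ∈ U, (c i : ℝ) * dist (g • o i) (o i) ≤ C) :
    ∃ y : BoundedFamily 𝒰 (fun _ => X) c o, y.IsEquicontinuous G := by
  set S : Set ℝ := {t | ∃ y : BoundedFamily 𝒰 (fun _ => X) c o, y.IsOrbitBound G t} with hS
  have hSne : S.Nonempty :=
    ⟨C, ⟨o, 0, fun i => by simp⟩, U, hU, Eventually.of_forall hC⟩
  have hSbdd : BddBelow S := ⟨0, fun t ⟨_, ht⟩ => ht.nonneg⟩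
  obtain ⟨r, hr⟩ : ∃ r, r = sInf S := ⟨_, rfl⟩
  have hr0 : 0 ≤ r := hr ▸ le_csInf hSne fun t ⟨_, ht⟩ => ht.nonneg
  have hrS : ∀ (y : BoundedFamily 𝒰 (fun _ => X) c o) (t : ℝ), y.IsOrbitBound G t → r ≤ t :=
    fun y t ht => hr ▸ csInf_le hSbdd ⟨y, ht⟩
  have hex : ∀ n : ℕ, ∃ z : BoundedFamily 𝒰 (fun _ => X) c o,
      z.IsOrbitBound G (r + 1 / ((n : ℝ) + 1)) := fun n => by
    obtain ⟨t, ⟨z, hz⟩, ht⟩ := exists_lt_of_csInf_lt hSne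
      (show sInf S < r + 1 / ((n : ℝ) + 1) by
        rw [← hr]
        exact lt_add_of_pos_right _ (by positivity))
    exact ⟨z, hz.mono ht.le⟩
  choose z hz using hex
  have hz' : ∀ η : ℝ, 0 < η → ∃ N, ∀ n ≥ N, (z n).IsOrbitBound G (r + η) := fun η hη => by
    obtain ⟨N, hN⟩ := exists_nat_one_div_lt hη
    refine ⟨N, fun n hn => (hz n).mono ?_⟩
    have := one_div_le_one_div_of_le (by positivity)
      (show (N : ℝ) + 1 ≤ (n : ℝ) + 1 by gcongr)
    linarith
  have hcauchy : CauchySeq z := by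
    refine Metric.cauchySeq_iff.2 fun ε hε => ?_
    obtain ⟨η, hη, h⟩ := exists_dist_le_of_isOrbitBound hX hc hr0 hrS (half_pos hε)
    obtain ⟨N, hN⟩ := hz' η hη
    exact ⟨N, fun m hm n hn => (h _ _ (hN m hm) (hN n hn)).trans_lt (half_lt_self hε)⟩
  obtain ⟨y, hy⟩ := cauchySeq_tendsto_of_complete hcauchy
  have hyr : ∀ η : ℝ, 0 < η → y.IsOrbitBound G (r + η) := fun η hη => by
    obtain ⟨N, hN⟩ := hz' (η / 2) (half_pos hη)
    obtain ⟨M, hM⟩ := Metric.tendsto_atTop.1 hy (η / 2) (half_pos hη)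
    have := (hN _ (le_max_left N M)).of_dist_lt (hM _ (le_max_right N M))
    exact this.mono (by linarith)
  refine ⟨y, fun ε hε => ?_⟩
  obtain ⟨η, hη, h⟩ := exists_dist_le_of_isOrbitBound hX hc hr0 hrS (half_pos hε)
  obtain ⟨V, hV, hyV⟩ := hyr η hη
  have hdiv : ∀ᶠ p : G × G in 𝓝 1 ×ˢ 𝓝 1, p.1⁻¹ * p.2 ∈ V := by
    have : Tendsto (fun p : G × G => p.1⁻¹ * p.2) (𝓝 (1, 1)) (𝓝 1) :=
      Continuous.tendsto' (by fun_prop) _ _ (by simp)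
    rw [← nhds_prod_eq]
    exact this hV
  obtain ⟨W, hW, hWV⟩ := eventually_prod_self_iff'.1 hdiv
  -- `W` keeps translates of `y` almost minimal; `U` keeps them bounded.
  refine ⟨W ∩ U, inter_mem hW hU, ?_⟩
  by_contra hcon
  rw [← Ultrafilter.eventually_not] at hcon
  have hsel : ∀ i, ∃ g ∈ W ∩ U, (¬ ∀ g ∈ W ∩ U, (c i : ℝ) * dist (g • y.val i) (y.val i) ≤ ε) →
      ε < (c i : ℝ) * dist (g • y.val i) (y.val i) := fun i => by
    by_cases hi : ∀ g ∈ W ∩ U, (c i : ℝ) * dist (g • y.val i) (y.val i) ≤ ε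
    -- Default value at indices with no violating element.
    · exact ⟨1, mem_of_mem_nhds (inter_mem hW hU), fun h => absurd hi h⟩
    · obtain ⟨g, hg, hgi⟩ := not_forall₂.1 hi
      exact ⟨g, hg, fun _ => not_le.1 hgi⟩
  choose k hkW hk using hsel
  obtain ⟨D, hD⟩ := y.bounded
  let w : BoundedFamily 𝒰 (fun _ => X) c o := ⟨fun i => k i • y.val i, C + D, fun i => by
    have := mul_le_mul_of_nonneg_left
      (dist_triangle_left (o i) (k i • y.val i) (k i • o i)) (c i).coe_nonneg
    rw [dist_smul] at this
    linarith [hD i, hC i (k i) (hkW i).2]⟩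
  -- The distance from `g • o i` to `k i • y.val i` is that from `((k i)⁻¹ * g) • o i` to `y.val i`,
  -- and `(k i)⁻¹ * g` lies in `V`.
  have hw : w.IsOrbitBound G (r + η) := by
    refine ⟨W, hW, hyV.mono fun i hi g hg => ?_⟩
    have := hi _ (hWV (k i) (hkW i).1 g hg)
    rwa [mul_smul, dist_inv_smul_eq] at this
  have h1 := h w y hw (hyr η hη)
  have h2 : ε ≤ dist w y := le_dist_of_eventually (hcon.mono fun i hi => (hk i hi).le)
  linarith

theorem isClosed_setOf_isEquicontinuous :
    IsClosed {y : BoundedFamily 𝒰 (fun _ => X) c o | y.IsEquicontinuous G} := by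
  refine isClosed_of_closure_subset fun y hy η hη => ?_
  obtain ⟨z, hz, hyz⟩ := Metric.mem_closure_iff.1 hy (η / 3) (by positivity)
  obtain ⟨U, hU, h⟩ := hz (η / 3) (by positivity)
  refine ⟨U, hU, (h.and (eventually_le_of_dist_lt hyz)).mono fun i hi g hg => ?_⟩
  have := mul_le_mul_of_nonneg_left
    (dist_triangle4 (g • y.val i) (g • z.val i) (z.val i) (y.val i)) (c i).coe_nonneg
  rw [dist_smul, dist_comm (z.val i) (y.val i)] at this
  linarith [hi.1 g hg, hi.2]

/-- An element near 1 moves both endpoints little, hence the whole geodesic little, by a modulus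
independent of the scale `c i`. -/
theorem IsEquicontinuous.geodesicPoint (hX : IsUniformlyConvexMetricSpace X)
    (hc : ∀ i, 0 < c i) {y z : BoundedFamily 𝒰 (fun _ => X) c o}
    (hy : y.IsEquicontinuous G) (hz : z.IsEquicontinuous G) {γ : I → ℝ → X}
    (hγ : ∀ i, IsGeodesic (γ i) (y.val i) (z.val i)) (t : Icc (0 : ℝ) 1) :
    (y.geodesicPoint z hγ t).IsEquicontinuous G := by
  intro ε hε
  obtain ⟨L, hL⟩ := y.exists_dist_bound z
  obtain ⟨η, hη, h⟩ := hX.exists_dist_geodesic_le (abs_nonneg L) hε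
  obtain ⟨U, hU, hyU⟩ := hy η hη
  obtain ⟨V, hV, hzV⟩ := hz η hη
  refine ⟨U ∩ V, inter_mem hU hV, (hyU.and hzV).mono fun i hi g hg => ?_⟩
  refine h (c i) _ _ _ _ _ (γ i) t (hc i) ((hγ i).comp_isometry (isometry_smul X g)) (hγ i) t.2
    ?_ (hi.1 g hg.1) (hi.2 g hg.2)
  rw [dist_smul]
  exact (hL i).trans (le_abs_self L)

/-- `g` moves `h • y` as far as `h⁻¹ * g * h` moves `y`, and conjugation is continuous at 1. -/
theorem IsEquicontinuous.smul [IsTopologicalGroup G]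
    {y w : BoundedFamily 𝒰 (fun _ => X) c o} (hy : y.IsEquicontinuous G) (h : G)
    (hw : ∀ i, w.val i = h • y.val i) : w.IsEquicontinuous G := by
  intro η hη
  obtain ⟨U, hU, hyU⟩ := hy η hη
  have : Tendsto (fun g => h⁻¹ * g * h) (𝓝 1) (𝓝 1) :=
    Continuous.tendsto' (by fun_prop) _ _ (by simp)
  refine ⟨_, this hU, hyU.mono fun i hi g hg => ?_⟩
  have := hi _ hg
  rwa [mul_smul, mul_smul, dist_inv_smul_eq, ← hw] at this

/-- Equicontinuity makes pointwise bounds on the displacement uniform on compact sets. -/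
theorem IsEquicontinuous.eventually_forall_dist_le [IsTopologicalGroup G]
    {y : BoundedFamily 𝒰 (fun _ => X) c o} (hy : y.IsEquicontinuous G) {K : Set G}
    (hK : IsCompact K) {s t : ℝ} (hst : s < t)
    (h : ∀ g ∈ K, ∀ᶠ i in 𝒰, (c i : ℝ) * dist (g • y.val i) (y.val i) ≤ s) :
    ∀ᶠ i in 𝒰, ∀ g ∈ K, (c i : ℝ) * dist (g • y.val i) (y.val i) ≤ t := by
  obtain ⟨U, hU, hyU⟩ := hy (t - s) (sub_pos.2 hst)
  refine hK.induction_on (p := fun A => ∀ᶠ i in 𝒰, ∀ g ∈ A,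
    (c i : ℝ) * dist (g • y.val i) (y.val i) ≤ t) (by simp)
    (fun A B hAB hB => hB.mono fun i hi g hg => hi g (hAB hg))
    (fun A B hA hB => (hA.and hB).mono fun i hi g hg => hg.elim (hi.1 g) (hi.2 g))
    fun g hg => ?_
  have : Tendsto (fun k => g⁻¹ * k) (𝓝 g) (𝓝 1) :=
    Continuous.tendsto' (by fun_prop) _ _ (by simp)
  -- For `k` in `g U`, the displacement by `k` exceeds that by `g` by at most `t - s`; compactness
  -- leaves finitely many `g`.
  refine ⟨_, mem_nhdsWithin_of_mem_nhds (this hU), ?_⟩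
  filter_upwards [hyU, h g hg] with i hi hgi k hk
  have h1 := hi _ hk
  rw [mul_smul, ← dist_smul g, smul_inv_smul] at h1
  have := mul_le_mul_of_nonneg_left
    (dist_triangle (k • y.val i) (g • y.val i) (y.val i)) (c i).coe_nonneg
  linarith

/-- If the rescaled displacement of the base points is bounded for each `g`, then `G` acts
coordinatewise on the bounded families. -/
abbrev mulAction (𝒰 : Ultrafilter I)
    (h : ∀ g : G, ∃ C : ℝ, ∀ i, (c i : ℝ) * dist (g • o i) (o i) ≤ C) :
    MulAction G (BoundedFamily 𝒰 (fun _ => X) c o) where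
  smul g y :=
    { val := fun i => g • y.val i
      bounded := by
        obtain ⟨C, hC⟩ := y.bounded
        obtain ⟨D, hD⟩ := h g
        refine ⟨D + C, fun i => ?_⟩
        have := mul_le_mul_of_nonneg_left (dist_triangle_left (o i) (g • y.val i) (g • o i))
          (c i).coe_nonneg
        rw [dist_smul] at this
        linarith [hC i, hD i] }
  one_smul y := val_injective (funext fun i => one_smul G (y.val i))
  mul_smul g h y := val_injective (funext fun i => mul_smul g h (y.val i))

end Action

end BoundedFamily

/-! ### Displacement and Hofer's lemma. -/

section Displacement

variable {X : Type u} [MetricSpace X] {G : Type v} [Group G] [MulAction G X]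

/-- The largest distance by which an element of `K` moves `x`. -/
noncomputable def displacement (K : Set G) (x : X) : ℝ :=
  ⨆ g : K, dist ((g : G) • x) x

theorem displacement_nonneg (K : Set G) (x : X) : 0 ≤ displacement K x :=
  Real.iSup_nonneg fun _ => dist_nonneg

theorem displacement_le {K : Set G} {x : X} {t : ℝ} (ht : 0 ≤ t)
    (h : ∀ g ∈ K, dist (g • x) x ≤ t) : displacement K x ≤ t :=
  Real.iSup_le (fun g => h g g.2) ht

variable {K : Set G} (hK : ∀ x : X, ∃ C : ℝ, ∀ g ∈ K, dist (g • x) x ≤ C)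
include hK

theorem dist_smul_le_displacement {g : G} (hg : g ∈ K) (x : X) :
    dist (g • x) x ≤ displacement K x := by
  obtain ⟨C, hC⟩ := hK x
  exact le_ciSup (f := fun g : K => dist ((g : G) • x) x)
    ⟨C, by rintro _ ⟨g, rfl⟩; exact hC g g.2⟩ ⟨g, hg⟩

variable [IsIsometricSMul G X]

theorem lipschitzWith_displacement : LipschitzWith 2 (displacement K : X → ℝ) := by
  refine LipschitzWith.of_le_add_mul 2 fun x y => displacement_le ?_ fun g hg => ?_
  · exact add_nonneg (displacement_nonneg K y) (by positivity)
  · have h1 := dist_triangle4 (g • x) (g • y) y x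
    have h2 := dist_smul_le_displacement hK hg y
    rw [dist_smul, dist_comm y x] at h1
    rw [NNReal.coe_ofNat]
    linarith

/-- If `K` has no common fixed point, there are points whose displacement is almost minimal on a
ball which is large compared to this displacement. -/
theorem exists_displacement_le_two_mul [CompleteSpace X] [Nonempty X]
    (hpos : ∀ x : X, 0 < displacement K x) {R : ℝ} (hR : 0 < R) :
    ∃ x : X, ∀ y, dist x y ≤ R * displacement K x → displacement K x ≤ 2 * displacement K y := by
  obtain ⟨x₀⟩ := ‹Nonempty X›
  -- With `ϕ` the inverse displacement, this radius makes radius times `ϕ x₀` equal to `R`. Hofer's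
  -- lemma does not decrease that product, so the new radius is at least `R * displacement K x`.
  obtain ⟨ε, -, x, -, -, hx, hy⟩ := hofer x₀ (R * displacement K x₀) (mul_pos hR (hpos x₀))
    (ϕ := fun x => (displacement K x)⁻¹)
    ((lipschitzWith_displacement hK).continuous.inv₀ fun x => (hpos x).ne')
    fun x => (inv_pos.2 (hpos x)).le
  rw [mul_inv_cancel_right₀ (hpos x₀).ne', ← div_eq_mul_inv, le_div_iff₀ (hpos x)] at hx
  refine ⟨x, fun y hxy => ?_⟩
  have := hy y (hxy.trans hx)
  rwa [inv_le_iff_one_le_mul₀ (hpos y), mul_right_comm, ← div_eq_mul_inv,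
    one_le_div (hpos x)] at this

end Displacement

/-! ### Continuous actions and generating neighbourhoods. -/

section ContinuousActions

theorem ContinuousSMul.of_tendsto_one {Y : Type u} [MetricSpace Y] {G : Type v} [Group G]
    [TopologicalSpace G] [IsTopologicalGroup G] [MulAction G Y] [IsIsometricSMul G Y]
    (h : ∀ y : Y, Tendsto (fun g : G => g • y) (𝓝 1) (𝓝 y)) : ContinuousSMul G Y := by
  refine ⟨continuous_iff_continuousAt.2 fun ⟨g, y⟩ => tendsto_iff_dist_tendsto_zero.2 ?_⟩
  have h1 : Tendsto (fun p : G × Y => g⁻¹ * p.1) (𝓝 (g, y)) (𝓝 1) :=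
    Continuous.tendsto' (by fun_prop) _ _ (by simp)
  have h2 := tendsto_iff_dist_tendsto_zero.1 ((h y).comp h1)
  have h3 : Tendsto (fun p : G × Y => dist p.2 y) (𝓝 (g, y)) (𝓝 0) :=
    Continuous.tendsto' (by fun_prop) _ _ (by simp)
  refine squeeze_zero (fun _ => dist_nonneg) (fun p => ?_) (by simpa using h3.add h2)
  calc dist (p.1 • p.2) (g • y) ≤ dist (p.1 • p.2) (p.1 • y) + dist (p.1 • y) (g • y) :=
        dist_triangle _ _ _
    _ = dist p.2 y + dist ((g⁻¹ * p.1) • y) y := by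
        rw [dist_smul, mul_smul, dist_inv_smul_eq]

/-- Makes the topological form a special case of the coarse one. -/
theorem isControlledAction_of_continuousSMul (G : Type v) [Group G] [TopologicalSpace G] [T2Space G]
    (X : Type u) [MetricSpace X] [MulAction G X] [ContinuousSMul G X] :
    IsControlledAction G (Bornology.relativelyCompact G) X := fun _ hA _ =>
  ((Bornology.relativelyCompact.isBounded_iff.1 hA).image
    (continuous_id.smul continuous_const)).isBounded.subset (image_mono subset_closure)

/-- A generating set that is also a neighbourhood of 1 lets the displacement bound on `K` start the
asymptotic center argument. -/
theorem IsCompactlyGeneratedGroup.exists_mem_nhds {G : Type v} [Group G] [TopologicalSpace G]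
    [LocallyCompactSpace G] (hG : IsCompactlyGeneratedGroup G) :
    ∃ K : Set G, IsCompact K ∧ K ∈ 𝓝 1 ∧ Subgroup.closure K = ⊤ := by
  obtain ⟨K, hK, hgen⟩ := hG
  obtain ⟨V, hV, hV1⟩ := exists_compact_mem_nhds (1 : G)
  exact ⟨K ∪ V, hK.union hV, mem_of_superset hV1 subset_union_right,
    top_le_iff.1 (hgen.ge.trans (Subgroup.closure_mono subset_union_left))⟩

end ContinuousActions

/-! ### Almost fixed points in the equicontinuous part of the ultraproduct. -/

section Ultraproduct

variable {𝒳 : (X : Type u) → [MetricSpace X] → Prop} {G : Type v} [Group G] [TopologicalSpace G]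
  [IsTopologicalGroup G]

/-- In a rescaled ultraproduct of isometric actions whose base points have bounded rescaled
displacements, there are almost fixed families, uniformly on compact sets. -/
theorem BoundedFamily.exists_eventually_dist_smul_le [T2Space G]
    (h𝒳_convex : ∀ (X : Type u) [MetricSpace X], 𝒳 X → IsUniformlyConvexMetricSpace X)
    (h𝒳_ultraproducts : StableUnderRescaledUltraproducts 𝒳)
    (h𝒳_subspaces : ClosedUnderClosedConvexSubspaces 𝒳)
    (h_almost : ∀ (X : Type u) [MetricSpace X] [Nonempty X] [MulAction G X] [IsIsometricSMul G X]
      [ContinuousSMul G X], 𝒳 X → HasAlmostFixedPoints G (Bornology.relativelyCompact G) X)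
    {X : Type u} [MetricSpace X] [MulAction G X] [IsIsometricSMul G X] (hX : 𝒳 X)
    {I : Type u} (𝒰 : Ultrafilter I) {c : I → ℝ≥0} (hc : ∀ i, 0 < c i) {o : I → X}
    (hbdd : ∀ g : G, ∃ C : ℝ, ∀ i, (c i : ℝ) * dist (g • o i) (o i) ≤ C)
    {U : Set G} (hU : U ∈ 𝓝 1) {C : ℝ}
    (hC : ∀ i, ∀ g ∈ U, (c i : ℝ) * dist (g • o i) (o i) ≤ C)
    {K : Set G} (hK : IsCompact K) {ε : ℝ} (hε : 0 < ε) :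
    ∃ y : BoundedFamily 𝒰 (fun _ => X) c o,
      ∀ᶠ i in 𝒰, ∀ g ∈ K, (c i : ℝ) * dist (g • y.val i) (y.val i) ≤ ε := by
  have hXc := h𝒳_convex X hX
  have hY := h𝒳_ultraproducts I 𝒰 (fun _ => X) c o (fun _ => hX) hc
  have hYc : IsUniquelyGeodesic (RescaledUltraproduct 𝒰 (fun _ => X) c o) ∧
      CompleteSpace (RescaledUltraproduct 𝒰 (fun _ => X) c o) := by
    obtain ⟨Z, _, hZ, ⟨e⟩⟩ := hY
    have := (h𝒳_convex Z hZ).complete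
    exact ⟨(h𝒳_convex Z hZ).uniquelyGeodesic.of_isometryEquiv e,
      e.symm.completeSpace⟩
  have := hYc.2
  have : CompleteSpace (BoundedFamily 𝒰 (fun _ => X) c o) :=
    SeparationQuotient.completeSpace_iff.1 this
  let E : Set (BoundedFamily 𝒰 (fun _ => X) c o) := {y | y.IsEquicontinuous G}
  have hE : IsClosed E := BoundedFamily.isClosed_setOf_isEquicontinuous
  let A : Set (RescaledUltraproduct 𝒰 (fun _ => X) c o) := SeparationQuotient.mk '' E
  obtain ⟨y₀, hy₀⟩ :=
    BoundedFamily.exists_isEquicontinuous (𝒰 := 𝒰) (o := o) hXc hc hU hC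
  have hA : MemUpToIsometry 𝒳 A := by
    refine hY.subspace h𝒳_subspaces ⟨_, y₀, hy₀, rfl⟩
      (SeparationQuotient.isClosedMap_mk E hE) ?_
    rintro _ ⟨y, hy, rfl⟩ _ ⟨z, hz, rfl⟩ _ ⟨γ, hγ, t, ht, rfl⟩
    choose γ' hγ' using fun i => hXc.uniquelyGeodesic.exists_geodesic (y.val i) (z.val i)
    -- By uniqueness, an arbitrary geodesic of the ultraproduct is a limit of coordinate geodesics.
    rw [hYc.1.unique_geodesic _ _ _ _ hγ (y.isGeodesic_mk_geodesicPoint z hγ') ht]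
    exact ⟨_, hy.geodesicPoint hXc hc hz hγ' _, rfl⟩
  let _ : MulAction G (BoundedFamily 𝒰 (fun _ => X) c o) := BoundedFamily.mulAction 𝒰 hbdd
  have hsmul : IsIsometricSMul G (BoundedFamily 𝒰 (fun _ => X) c o) :=
    ⟨fun g => Isometry.of_dist_eq fun y z => tendsto_nhds_unique
      (BoundedFamily.tendsto_dist _ _) ((y.tendsto_dist z).congr fun i =>
        congrArg _ (dist_smul g (y.val i) (z.val i)).symm)⟩
  have hsmul' : IsIsometricSMul G (RescaledUltraproduct 𝒰 (fun _ => X) c o) :=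
    ⟨fun g => Isometry.of_dist_eq <| SeparationQuotient.surjective_mk.forall₂.2
      fun y z => by
        rw [← SeparationQuotient.mk_smul, ← SeparationQuotient.mk_smul,
          SeparationQuotient.dist_mk, SeparationQuotient.dist_mk, dist_smul]⟩
  have hAinv : ∀ (g : G), ∀ q ∈ A, g • q ∈ A := by
    rintro g _ ⟨y, hy, rfl⟩
    exact ⟨g • y, hy.smul g fun i => rfl, rfl⟩
  let _ : MulAction G A :=
    { smul := fun g q => ⟨g • q.1, hAinv g q.1 q.2⟩
      one_smul := fun q => Subtype.ext (one_smul G q.1)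
      mul_smul := fun g h q => Subtype.ext (mul_smul g h q.1) }
  have : IsIsometricSMul G A :=
    ⟨fun g => Isometry.of_dist_eq fun p q => dist_smul g p.1 q.1⟩
  have : ContinuousSMul G A := by
    refine ContinuousSMul.of_tendsto_one ?_
    rintro ⟨_, y, hy, rfl⟩
    refine tendsto_subtype_rng.2 (Metric.tendsto_nhds.2 fun η hη => ?_)
    obtain ⟨V, hV, hyV⟩ := hy (η / 2) (half_pos hη)
    filter_upwards [hV] with g hg
    exact (BoundedFamily.dist_le_of_eventually (y := g • y) (z := y)
      (hyV.mono fun i hi => hi g hg)).trans_lt (half_lt_self hη)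
  have : Nonempty A := ⟨⟨_, y₀, hy₀, rfl⟩⟩
  -- The slack is spent twice: `ε / 3` in the limit gives `ε / 2` along `𝒰` for each `g`, then `ε`
  -- uniformly on `K`.
  obtain ⟨⟨_, y, hy, rfl⟩, hyK⟩ := HasAlmostFixedPoints.of_memUpToIsometry h_almost hA (ε / 3)
    (by positivity) K (Bornology.relativelyCompact.isBounded_iff.2 hK.closure)
  refine ⟨y, hy.eventually_forall_dist_le hK (s := ε / 2) (by linarith) fun g hg => ?_⟩
  exact BoundedFamily.eventually_le_of_dist_lt (y := g • y) (z := y)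
    (lt_of_le_of_lt (hyK g hg) (by linarith))

end Ultraproduct

/-! ### The contradiction by rescaling. -/

theorem coarsePropertyF_of_hasAlmostFixedPoints
    {𝒳 : (X : Type u) → [MetricSpace X] → Prop}
    (h𝒳_convex : ∀ (X : Type u) [MetricSpace X], 𝒳 X → IsUniformlyConvexMetricSpace X)
    (h𝒳_ultraproducts : StableUnderRescaledUltraproducts 𝒳)
    (h𝒳_subspaces : ClosedUnderClosedConvexSubspaces 𝒳)
    {G : Type v} [Group G] [TopologicalSpace G] [IsTopologicalGroup G] [T2Space G]
    [LocallyCompactSpace G] (hG : IsCompactlyGeneratedGroup G)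
    (h_almost : ∀ (X : Type u) [MetricSpace X] [Nonempty X] [MulAction G X] [IsIsometricSMul G X]
      [ContinuousSMul G X], 𝒳 X → HasAlmostFixedPoints G (Bornology.relativelyCompact G) X) :
    CoarsePropertyF 𝒳 G (Bornology.relativelyCompact G) := by
  intro X _ _ _ _ hX hcontrolled
  obtain ⟨K, hK, hK1, hgen⟩ := hG.exists_mem_nhds
  have := (h𝒳_convex X hX).complete
  have hKb : ∀ x : X, ∃ C : ℝ, ∀ g ∈ K, dist (g • x) x ≤ C := fun x => by
    obtain ⟨C, hC⟩ := Metric.isBounded_iff.1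
      (hcontrolled K (Bornology.relativelyCompact.isBounded_iff.2 hK.closure) x)
    exact ⟨C, fun g hg => hC ⟨g, hg, rfl⟩ ⟨1, mem_of_mem_nhds hK1, one_smul G x⟩⟩
  by_contra! hfix
  have hpos : ∀ x : X, 0 < displacement K x := fun x => by
    refine (displacement_nonneg K x).lt_of_ne fun h0 => ?_
    obtain ⟨g, hg⟩ := hfix x
    have hle : Subgroup.closure K ≤ MulAction.stabilizer G x :=
      (Subgroup.closure_le _).2 fun k hk => dist_le_zero.1
        ((dist_smul_le_displacement hKb hk x).trans h0.ge)
    exact hg (hle (hgen ▸ Subgroup.mem_top g))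
  -- The radii tend to infinity, so every bounded family eventually lies in the controlled balls.
  -- `ULift` puts the index set in the universe of `𝒳`.
  choose o ho using fun i : ULift.{u} ℕ =>
    exists_displacement_le_two_mul hKb hpos (R := (i.down : ℝ) + 1) (by positivity)
  let c : ULift.{u} ℕ → ℝ≥0 := fun i => ⟨(displacement K (o i))⁻¹, (inv_pos.2 (hpos _)).le⟩
  have hc : ∀ i, 0 < c i := fun i => inv_pos.2 (hpos (o i))
  have hc_mul : ∀ i (t s : ℝ), (c i : ℝ) * t ≤ s ↔ t ≤ displacement K (o i) * s := fun i t s =>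
    inv_mul_le_iff₀ (hpos (o i))
  have hC : ∀ i, ∀ g ∈ K, (c i : ℝ) * dist (g • o i) (o i) ≤ 1 := fun i g hg => by
    rw [hc_mul, mul_one]
    exact dist_smul_le_displacement hKb hg _
  have hbdd : ∀ g : G, ∃ C : ℝ, ∀ i, (c i : ℝ) * dist (g • o i) (o i) ≤ C := fun g => by
    have hg : g ∈ Subgroup.closure K := hgen ▸ Subgroup.mem_top g
    induction hg using Subgroup.closure_induction with
    | mem g hg => exact ⟨1, fun i => hC i g hg⟩
    | one => exact ⟨0, fun i => by simp⟩
    | mul g h _ _ hg hh =>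
      obtain ⟨C, hC⟩ := hg
      obtain ⟨D, hD⟩ := hh
      refine ⟨C + D, fun i => ?_⟩
      have := mul_le_mul_of_nonneg_left
        (dist_triangle ((g * h) • o i) (g • o i) (o i)) (c i).coe_nonneg
      rw [mul_smul, dist_smul, ← mul_smul, mul_add] at this
      linarith [hC i, hD i]
    | inv g _ hg =>
      obtain ⟨C, hC⟩ := hg
      refine ⟨C, fun i => ?_⟩
      rw [dist_inv_smul_eq, dist_comm]
      exact hC i
  let 𝒰 : Ultrafilter (ULift.{u} ℕ) := (hyperfilter ℕ).map ULift.up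
  -- Any constant below the lower bound 1/2 given by `ho` would do in place of 1/4.
  obtain ⟨y, hy⟩ := BoundedFamily.exists_eventually_dist_smul_le h𝒳_convex h𝒳_ultraproducts
    h𝒳_subspaces h_almost hX 𝒰 hc hbdd hK1 hC hK (ε := 1 / 4) (by norm_num)
  obtain ⟨C, hyC⟩ := y.bounded
  obtain ⟨N, hN⟩ := exists_nat_ge C
  have hlarge : ∀ᶠ i : ULift.{u} ℕ in 𝒰, N ≤ i.down :=
    Nat.hyperfilter_le_atTop (eventually_ge_atTop N)
  obtain ⟨i, hi, hNi⟩ := (hy.and hlarge).exists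
  have h1 : displacement K (y.val i) ≤ displacement K (o i) * (1 / 4) :=
    displacement_le (mul_nonneg (hpos _).le (by norm_num)) fun g hg => (hc_mul i _ _).1 (hi g hg)
  have h2 : displacement K (o i) ≤ 2 * displacement K (y.val i) := by
    refine ho i _ (((hc_mul i _ _).1 (hyC i)).trans ?_)
    rw [mul_comm]
    have : (N : ℝ) ≤ i.down := by exact_mod_cast hNi
    exact mul_le_mul_of_nonneg_right (by linarith) (hpos _).le
  linarith [hpos (o i)]

theorem theoremB
    (𝒳 : (X : Type u) → [MetricSpace X] → Prop)
    (h𝒳_convex : ∀ (X : Type u) [MetricSpace X], 𝒳 X → IsUniformlyConvexMetricSpace X)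
    (h𝒳_ultraproducts : StableUnderRescaledUltraproducts 𝒳)
    (h𝒳_subspaces : ClosedUnderClosedConvexSubspaces 𝒳)
    (G : Type v) [Group G] [TopologicalSpace G] [IsTopologicalGroup G] [T2Space G]
    [LocallyCompactSpace G] (hG : IsCompactlyGeneratedGroup G)
    (h_almost : ∀ (X : Type u) [MetricSpace X] [Nonempty X] [MulAction G X] [IsIsometricSMul G X]
      [ContinuousSMul G X], 𝒳 X → HasAlmostFixedPoints G (Bornology.relativelyCompact G) X) :
    TopologicalPropertyF 𝒳 G ∧ CoarsePropertyF 𝒳 G (Bornology.relativelyCompact G) := by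
  have hcoarse := coarsePropertyF_of_hasAlmostFixedPoints h𝒳_convex h𝒳_ultraproducts
    h𝒳_subspaces hG h_almost
  exact ⟨fun X _ _ _ _ _ hX => hcoarse X hX (isControlledAction_of_continuousSMul G X), hcoarse⟩
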